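/- Let $X$ be a topological group with a $\sigma$-algebra and a measure $\mu$ on it such that at least one of the following holds: (i) $X$ is a measurable group (multiplication $X\times X\to X$ and inversion are measurable) and $\mu$ is $\sigma$-finite and left quasi-invariant: if $\mu(N)=0$ then $\mu(gN)=0$ for every $g\in X$ (for example, $\mu$ is a left-invariant $\sigma$-finite measure, or a probability measure with the same null sets as such a measure); (ii) $X$ is locally compact and $\mu$ is a (left or right) Haar measure, i.e. a regular Borel measure, finite on compact sets, positive on non-empty open sets, and left- (respectively right-) invariant. Let $\mathcal B$ be a differentiation basis for $\mu$: for every $x\in X$, a (non-trivial) notion of convergence $I\Rightarrow x$ of sets $I\subseteq X$ to $x$, given by a filter on the sets, for which the sets $I$ are eventually measurable, with $0<\mu(I)<\infty$, and contained in any given neighbourhood of $x$. Let $\mathcal D_\mu$ be the density topology generated by $\mu$ through $\mathcal B$: a set $U$ is $\mathcal D_\mu$-open if and only if every $x\in U$ is a density point of $U$, i.e. $\mu^*(I\setminus U)/\mu(I)\to 0$ as $I\Rightarrow x$, where $\mu^*$ is the outer measure of $\mu$. If $A\subseteq X$ is co-null (i.e. $\mu^*(X\setminus A)=0$) and $(z_n)_{n\in\mathbb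 N}$ is a null sequence in $X$ (i.e. $z_n\to 1_X$ in the group topology), then there is a set $H\subseteq A$ that is a $\mathcal G_\delta$ set for $\mathcal D_\mu$ and dense for $\mathcal D_\mu$, such that $a z_n\in A$ for all $a\in H$ and all $n\in\mathbb N$. -/

import Mathlib

open Filter Topology MeasureTheory

/-- A differentiation basis for a measure `μ` on a topological space: for every point `x`, a notion
`I ⇒ x` of convergence of sets `I` to `x`, recorded as a filter on sets (for a basis given by a
family of sequences of sets contracting to `x`, the supremum of the filters of their tails). The
sets that converge to `x` are eventually measurable, of positive and finite measure, and inside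
any prescribed neighbourhood of `x`. -/
structure DifferentiationBasis {X : Type*} [TopologicalSpace X] [MeasurableSpace X]
    (μ : Measure X) where
  conv : X → Filter (Set X)
  neBot : ∀ x, (conv x).NeBot
  measurableSet : ∀ x, ∀ᶠ I in conv x, MeasurableSet I
  measure_pos : ∀ x, ∀ᶠ I in conv x, 0 < μ I
  measure_lt_top : ∀ x, ∀ᶠ I in conv x, μ I < ⊤
  contracting : ∀ x, ∀ V ∈ 𝓝 x, ∀ᶠ I in conv x, I ⊆ V

namespace DifferentiationBasis

variable {X : Type*} [TopologicalSpace X] [MeasurableSpace X] {μ : Measure X}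

/-- `x` is a density point of `U`: the complement of `U` has (outer) density `0` at `x`. Here `μ` of
a set that need not be measurable is its outer measure. For measurable `U` this says that
`μ (I ∩ U) / μ I` tends to `1` as `I ⇒ x`. -/
def IsDensityPoint (B : DifferentiationBasis μ) (U : Set X) (x : X) : Prop :=
  Tendsto (fun I : Set X => μ (I \ U) / μ I) (B.conv x) (𝓝 0)

/-- The density topology generated by `μ` (through the basis `B`): a set is open when each of its
points is a density point of it. -/
@[reducible] def densityTopology (B : DifferentiationBasis μ) : TopologicalSpace X where
  IsOpen U := ∀ x ∈ U, B.IsDensityPoint U x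
  isOpen_univ := by
    intro x _
    simpa [IsDensityPoint] using tendsto_const_nhds
  isOpen_inter := by
    intro s t hs ht x hx
    have h := (hs x hx.1).add (ht x hx.2)
    rw [add_zero] at h
    refine tendsto_of_tendsto_of_tendsto_of_le_of_le tendsto_const_nhds h
      (fun _ => zero_le) (fun I => ?_)
    change μ (I \ (s ∩ t)) / μ I ≤ μ (I \ s) / μ I + μ (I \ t) / μ I
    rw [Set.sdiff_inter, ← ENNReal.add_div]
    exact ENNReal.div_le_div_right (measure_union_le _ _) _
  isOpen_sUnion := by
    intro S hS x hx
    obtain ⟨s, hs, hxs⟩ := hx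
    refine tendsto_of_tendsto_of_tendsto_of_le_of_le tendsto_const_nhds (hS s hs x hxs)
      (fun _ => zero_le) (fun I => ?_)
    exact ENNReal.div_le_div_right
      (measure_mono (Set.sdiff_subset_sdiff_right (Set.subset_sUnion_of_mem hs))) _

end DifferentiationBasis

/-- `X` with `μ` is a measurable group whose measure is `σ`-finite and left quasi-invariant:
multiplication and inversion are measurable, and left translations preserve null sets. A
left-invariant `σ`-finite measure, or a probability measure with the same null sets, is of this
kind. -/
def IsQuasiInvariantMeasurableGroup {X : Type*} [Group X] [MeasurableSpace X]
    (μ : Measure X) : Prop :=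
  MeasurableMul₂ X ∧ MeasurableInv X ∧ SigmaFinite μ ∧
    ∀ g : X, Measure.QuasiMeasurePreserving (fun x => g * x) μ μ

/-- `μ` is a (left or right) Haar measure on the locally compact group `X`: a regular Borel measure,
finite on compact sets, positive on nonempty open sets, and left-invariant (respectively
right-invariant, i.e. the image of a left Haar measure under inversion). -/
def IsHaarOnLocallyCompactGroup {X : Type*} [Group X] [TopologicalSpace X] [MeasurableSpace X]
    (μ : Measure X) : Prop :=
  LocallyCompactSpace X ∧ BorelSpace X ∧ μ.Regular ∧ (μ.IsHaarMeasure ∨ μ.inv.IsHaarMeasure)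

/-!
Every co-null set `H` is open for the density topology, because `μ (I \ H) = 0` for all `I`, and
it is dense, because a null set has no density points. So it suffices that `A` and its countably
many translates `A * (z n)⁻¹` are all co-null, i.e. that right translations preserve null sets.
For a `σ`-finite left quasi-invariant measure, Fubini shows that inversion preserves null sets, and
right translations are left translations conjugated by inversion. A left Haar measure need not be
`σ`-finite, but by uniqueness its right translates are multiples of it.
-/

section RightTranslation

variable {X : Type*} [Group X] [MeasurableSpace X] {μ : Measure X}

theorem quasiMeasurePreserving_inv_of_mul_left [MeasurableMul₂ X] [MeasurableInv X] [SFinite μ]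
    (hleft : ∀ g : X, Measure.QuasiMeasurePreserving (g * ·) μ μ) :
    Measure.QuasiMeasurePreserving (·⁻¹ : X → X) μ μ := by
  refine ⟨measurable_inv, Measure.AbsolutelyContinuous.mk fun N hN hN0 => ?_⟩
  rw [Measure.map_apply measurable_inv hN]
  rcases eq_zero_or_neZero μ with rfl | _
  · rfl
  have hprod : Measure.QuasiMeasurePreserving (fun p : X × X => p.2⁻¹ * p.1) (μ.prod μ) μ :=
    QuasiMeasurePreserving.prod_of_left (measurable_snd.inv.mul measurable_fst)
      (.of_forall fun y => hleft y⁻¹)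
  have hsections : ∀ᵐ x ∂μ, ∀ᵐ y ∂μ, y⁻¹ * x ∉ N :=
    Measure.ae_ae_of_ae_prod (hprod.ae (measure_eq_zero_iff_ae_notMem.1 hN0))
  obtain ⟨x, hx⟩ := hsections.exists
  -- Replacing `y` by `x * y` turns `y⁻¹ * x` into `y⁻¹`.
  have hinv : ∀ᵐ y ∂μ, y⁻¹ ∉ N := by
    simpa only [mul_inv_rev, inv_mul_cancel_right] using (hleft x).ae hx
  exact measure_eq_zero_iff_ae_notMem.2 hinv

theorem quasiMeasurePreserving_mul_right_of_mul_left [MeasurableMul₂ X] [MeasurableInv X]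
    [SFinite μ] (hleft : ∀ g : X, Measure.QuasiMeasurePreserving (g * ·) μ μ) (g : X) :
    Measure.QuasiMeasurePreserving (· * g) μ μ := by
  have hinv := quasiMeasurePreserving_inv_of_mul_left hleft
  simpa only [Function.comp_def, mul_inv_rev, inv_inv] using hinv.comp ((hleft g⁻¹).comp hinv)

theorem IsQuasiInvariantMeasurableGroup.quasiMeasurePreserving_mul_right
    (hμ : IsQuasiInvariantMeasurableGroup μ) (g : X) :
    Measure.QuasiMeasurePreserving (· * g) μ μ := by
  obtain ⟨_, _, _, hleft⟩ := hμ
  exact quasiMeasurePreserving_mul_right_of_mul_left hleft g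

variable [TopologicalSpace X] [IsTopologicalGroup X]

theorem quasiMeasurePreserving_mul_right_of_isHaarMeasure [LocallyCompactSpace X] [BorelSpace X]
    [μ.IsHaarMeasure] [μ.Regular] (g : X) : Measure.QuasiMeasurePreserving (· * g) μ μ := by
  have : (μ.map (· * g)).Regular := .map (Homeomorph.mulRight g)
  refine ⟨measurable_mul_const g, ?_⟩
  rw [Measure.isMulLeftInvariant_eq_smul_of_regular (μ.map (· * g)) μ]
  exact Measure.smul_absolutelyContinuous

theorem IsHaarOnLocallyCompactGroup.quasiMeasurePreserving_mul_right
    (hμ : IsHaarOnLocallyCompactGroup μ) (g : X) :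
    Measure.QuasiMeasurePreserving (· * g) μ μ := by
  obtain ⟨_, _, _, _ | _⟩ := hμ
  · exact quasiMeasurePreserving_mul_right_of_isHaarMeasure g
  · have : μ.IsMulRightInvariant := μ.inv_inv ▸ inferInstance
    exact (measurePreserving_mul_right μ g).quasiMeasurePreserving

end RightTranslation

namespace DifferentiationBasis

variable {X : Type*} [TopologicalSpace X] [MeasurableSpace X] {μ : Measure X}

theorem isOpen_densityTopology_of_mem_ae (B : DifferentiationBasis μ) {H : Set X}
    (hH : H ∈ ae μ) : IsOpen[B.densityTopology] H := by
  intro x _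
  have hdiff (I : Set X) : μ (I \ H) = 0 := measure_mono_null (fun _ hy => hy.2) hH
  simpa only [IsDensityPoint, hdiff, ENNReal.zero_div] using tendsto_const_nhds

theorem IsDensityPoint.measure_ne_zero {B : DifferentiationBasis μ} {U : Set X} {x : X}
    (hx : B.IsDensityPoint U x) : μ U ≠ 0 := by
  intro hU
  have := B.neBot x
  have hone : Tendsto (fun I => μ (I \ U) / μ I) (B.conv x) (𝓝 1) := by
    refine tendsto_const_nhds.congr' ?_
    filter_upwards [B.measure_pos x, B.measure_lt_top x] with I hpos hlt
    rw [measure_sdiff_null hU, ENNReal.div_self hpos.ne' hlt.ne]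
  exact zero_ne_one (tendsto_nhds_unique hx hone)

theorem isOpenPosMeasure_densityTopology (B : DifferentiationBasis μ) :
    @Measure.IsOpenPosMeasure X B.densityTopology _ μ :=
  @Measure.IsOpenPosMeasure.mk X B.densityTopology _ μ
    fun _ hU ⟨x, hx⟩ => (hU x hx).measure_ne_zero

theorem dense_densityTopology_of_mem_ae (B : DifferentiationBasis μ) {H : Set X}
    (hH : H ∈ ae μ) : @Dense X B.densityTopology H :=
  @Measure.dense_of_ae X B.densityTopology _ μ B.isOpenPosMeasure_densityTopology (· ∈ H) hH

end DifferentiationBasis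

theorem mainTheorem8_general {X : Type*} {ι : Sort*} [Mul X] [TopologicalSpace X]
    [MeasurableSpace X] [Countable ι] {μ : Measure X} (B : DifferentiationBasis μ) {z : ι → X}
    (hz : ∀ i, Measure.QuasiMeasurePreserving (· * z i) μ μ) {A : Set X} (hA : μ Aᶜ = 0) :
    ∃ H : Set X, IsOpen[B.densityTopology] H ∧ @Dense X B.densityTopology H ∧
      H ⊆ A ∧ ∀ a ∈ H, ∀ i, a * z i ∈ A := by
  have hA_ae : ∀ᵐ a ∂μ, a ∈ A := hA
  have hH : {a | a ∈ A ∧ ∀ i, a * z i ∈ A} ∈ ae μ :=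
    hA_ae.and (ae_all_iff.2 fun i => (hz i).ae hA_ae)
  exact ⟨_, B.isOpen_densityTopology_of_mem_ae hH, B.dense_densityTopology_of_mem_ae hH,
    fun _ ha => ha.1, fun _ ha => ha.2⟩

theorem mainTheorem8 {X : Type*} [Group X] [TopologicalSpace X] [IsTopologicalGroup X]
    [MeasurableSpace X] (μ : Measure X)
    (hμ : IsQuasiInvariantMeasurableGroup μ ∨ IsHaarOnLocallyCompactGroup μ)
    (B : DifferentiationBasis μ)
    (A : Set X) (hA : μ Aᶜ = 0)
    (z : ℕ → X) (hz : Tendsto z atTop (𝓝 1)) :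
    ∃ H : Set X, @IsGδ X B.densityTopology H ∧ @Dense X B.densityTopology H ∧
      H ⊆ A ∧ ∀ a ∈ H, ∀ n : ℕ, a * z n ∈ A := by
  obtain ⟨H, hH_open, hH⟩ := mainTheorem8_general B (fun n => hμ.elim
    (·.quasiMeasurePreserving_mul_right (z n)) (·.quasiMeasurePreserving_mul_right (z n))) hA
  exact ⟨H, @IsOpen.isGδ X B.densityTopology H hH_open, hH⟩
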